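/- Theorem. Let $G$ be a finite, simple, connected, cubic graph (every vertex has degree $3$) with $n$ vertices. For an integer $s\ge 0$, a path of length $s$ in $G$ is a sequence of vertices $(v_0,v_1,\dots,v_s)$ such that $v_{i-1}$ and $v_i$ are adjacent for $1\le i\le s$ and $v_{i-1}\ne v_{i+1}$ for $1\le i\le s-1$ (an $s$-arc: no immediate backtracking, while vertices may otherwise repeat). Call $G$ $s$-transitive if it has at least one path of length $s$ and if for each ordered pair $(P,Q)$ of paths of length $s$ there is an automorphism of $G$ that maps the $i$-th vertex of $P$ to the $i$-th vertex of $Q$ for every $i$; call $G$ $s$-regular if it is $s$-transitive and for each such pair $(P,Q)$ there is only one such automorphism. If $G$ is $s$-regular and $t$-transitive for some integers $s,t\ge 0$, then \[ |\mathrm{Aut}(G)| \le 48n. \] -/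

import Mathlib

namespace SimpleGraph

variable {V : Type*} (G : SimpleGraph V)

/-- `p 0, p 1, …, p s` is a path of length `s` of `G` in the sense of the theory of `s`-transitive
graphs (an `s`-arc): consecutive vertices are adjacent and consecutive edges are distinct, that is,
the path never turns straight back. Vertices may otherwise be repeated.
The graph is simple, so the edges of the path are determined by its vertices. -/
structure IsArc (s : ℕ) (p : Fin (s + 1) → V) : Prop where
  adj : ∀ i : Fin s, G.Adj (p i.castSucc) (p i.succ)
  ne : ∀ (i : ℕ) (hi : i + 2 < s + 1), p ⟨i, by omega⟩ ≠ p ⟨i + 2, hi⟩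

/-- `G` is `s`-transitive: it has a path of length `s`, and for each ordered pair `(p, q)` of such
paths some automorphism of `G` maps the `i`-th term of `p` to the `i`-th term of `q`, for all `i`. -/
def IsArcTransitive (s : ℕ) : Prop :=
  (∃ p, G.IsArc s p) ∧
    ∀ p q, G.IsArc s p → G.IsArc s q → ∃ f : G ≃g G, ∀ i, f (p i) = q i

/-- `G` is `s`-regular: it is `s`-transitive, and for each ordered pair `(p, q)` of paths of
length `s` only one automorphism of `G` maps `p` to `q` term by term. -/
def IsArcRegular (s : ℕ) : Prop :=
  G.IsArcTransitive s ∧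
    ∀ p q, G.IsArc s p → G.IsArc s q →
      ∀ f g : G ≃g G, (∀ i, f (p i) = q i) → (∀ i, g (p i) = q i) → f = g

end SimpleGraph

/-!
Counting arcs one vertex at a time, a cubic graph on `n` vertices has at most `3 * 2 ^ (s - 1) * n`
arcs of length `s ≥ 1`, and if the graph is `s`-regular an automorphism is determined by the image
of one such arc. Everything therefore rests on Tutte's bound `s ≤ 5` (`ArcFrame.le_five`).

For that bound, let `g` be a shunt, an automorphism moving some `s`-arc one step along itself; its
powers spread the arc out to a two-way infinite arc `α`, indexed by `ℤ`. By regularity exactly one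
nontrivial automorphism `x i` fixes `α i, …, α (i + s - 1)`. It is an involution, it moves
`α (i - 1)` and `α (i + s)`, and `g` conjugates `x i` to `x (i + 1)`. The pointwise stabilizer of
`α a, …, α b` is generated by those `x i` that lie in it (`ArcFrame.stab_le_closure`).

Let `m` be the least positive integer for which `x 0` and `x m` do not commute.

* `2 * m ≤ s + 1`: otherwise some `x k` commutes with each of `x 0, …, x s`. The group these generate
  has at most two orbits on vertices, represented by adjacent vertices that `x k` fixes, so `x k`
  would fix every vertex (`ArcFrame.exists_not_commute`).
* `2 * s - 2 ≤ 3 * m`: the commutator of `x 0` and `x m` fixes `α (m - 1), …, α (2 * s - m - 2)`,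
  since otherwise it would be the product of some `x μ` and of `x i` with `μ < i < m`, all of which
  commute with `x (m + μ)` except for `x μ`, while the commutator itself commutes with `x (m + μ)`
  (`IsCommGap.commutator_mem_stab_right`). Reversing `α` gives a second fixed stretch, and an
  automorphism that fixes an arc of length `s` is trivial.

Together these leave, for `s ≥ 6`, only `s = 7` and `m = 4`. In that case the stabilizer of
`α 4, …, α 7` is normalized by `x 0` and `x 6`; but `x 0 * x 6` conjugates into `x 5` an element of
that stabilizer, whereas `x 5` moves `α 4` (`ArcFrame.not_isCommGap_four`).
-/

open scoped commutatorElement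

namespace SimpleGraph

/-! ### Arc frames and their stabilizers -/

variable {V : Type*} {G : SimpleGraph V}

/-- A two-way infinite arc `α` of `G`, translated by an automorphism `g`, together with nontrivial
automorphisms `x i` that fix `α i, …, α (i + s - 1)` and are translated by conjugation with `g`.
The field `third` says that no vertex has more than three neighbours, and `eq_one` is the
uniqueness part of `s`-regularity along `α`. The length `s` is an integer, so that no subtraction
of indices truncates. -/
structure ArcFrame (G : SimpleGraph V) (s : ℤ) where
  g : G ≃g G
  α : ℤ → V
  x : ℤ → (G ≃g G)
  g_apply : ∀ i, g (α i) = α (i + 1)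
  adj : ∀ i, G.Adj (α i) (α (i + 1))
  ne : ∀ i, α i ≠ α (i + 2)
  x_apply : ∀ i j, i ≤ j → j < i + s → x i (α j) = α j
  x_ne_one : ∀ i, x i ≠ 1
  x_succ : ∀ i, x (i + 1) = g * x i * g⁻¹
  third : ∀ v a b c d, G.Adj v a → G.Adj v b → G.Adj v c → G.Adj v d → a ≠ b → c ≠ a → c ≠ b →
    d ≠ a → d ≠ b → c = d
  eq_one : ∀ (f : G ≃g G) i, (∀ j, i ≤ j → j ≤ i + s → f (α j) = α j) → f = 1

namespace ArcFrame

variable {s : ℤ} (F : ArcFrame G s)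

/-- The frame obtained by traversing `α` backwards. Since `x i` fixes `s` consecutive vertices and
is indexed by the first of them, its index changes to `1 - s - i`. -/
def reverse : ArcFrame G s where
  g := F.g⁻¹
  α i := F.α (-i)
  x i := F.x (1 - s - i)
  g_apply i := by
    have h := F.g_apply (-(i + 1))
    rw [show -(i + 1) + 1 = -i by ring] at h
    rw [← h]
    exact RelIso.inv_apply_self _ _
  adj i := by
    have h := F.adj (-(i + 1))
    rw [show -(i + 1) + 1 = -i by ring] at h
    exact h.symm
  ne i := by
    have h := F.ne (-(i + 2))
    rw [show -(i + 2) + 2 = -i by ring] at h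
    exact h.symm
  x_apply i j h₁ h₂ := F.x_apply _ _ (by omega) (by omega)
  x_ne_one i := F.x_ne_one _
  x_succ i := by
    have h := F.x_succ (1 - s - (i + 1))
    rw [show 1 - s - (i + 1) + 1 = 1 - s - i by ring] at h
    rw [h]
    group
  third := F.third
  eq_one f i h := F.eq_one f (-(i + s)) fun j h₁ h₂ => by
    simpa using h (-j) (by omega) (by omega)

/-- The pointwise stabilizer of `α a, …, α b`. -/
def stab (a b : ℤ) : Subgroup (G ≃g G) where
  carrier := {f | ∀ j, a ≤ j → j ≤ b → f (F.α j) = F.α j}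
  one_mem' _ _ _ := rfl
  mul_mem' {f h} hf hh j h₁ h₂ := by
    rw [RelIso.mul_apply, hh j h₁ h₂, hf j h₁ h₂]
  inv_mem' {f} hf j h₁ h₂ := by
    conv_lhs => rw [← hf j h₁ h₂]
    exact RelIso.inv_apply_self _ _

lemma stab_mono {a b a' b' : ℤ} (ha : a ≤ a') (hb : b' ≤ b) : F.stab a b ≤ F.stab a' b' :=
  fun _ hf j h₁ h₂ => hf j (ha.trans h₁) (h₂.trans hb)

lemma eq_one_of_mem_stab {a b : ℤ} {f : G ≃g G} (hf : f ∈ F.stab a b) (h : a + s ≤ b) : f = 1 :=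
  F.eq_one f a fun j h₁ h₂ => hf j h₁ (by omega)

lemma mem_stab_succ {a b : ℤ} {f : G ≃g G} (hf : f ∈ F.stab a b)
    (h : f (F.α (b + 1)) = F.α (b + 1)) : f ∈ F.stab a (b + 1) := fun j h₁ h₂ => by
  rcases eq_or_lt_of_le h₂ with rfl | h₃
  · exact h
  · exact hf j h₁ (by omega)

lemma mem_stab_pred {a b : ℤ} {f : G ≃g G} (hf : f ∈ F.stab a b)
    (h : f (F.α (a - 1)) = F.α (a - 1)) : f ∈ F.stab (a - 1) b := fun j h₁ h₂ => by
  rcases eq_or_lt_of_le h₁ with rfl | h₃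
  · exact h
  · exact hf j (by omega) h₂

lemma x_mem_stab {i a b : ℤ} (ha : i ≤ a) (hb : b < i + s) : F.x i ∈ F.stab a b :=
  fun j h₁ h₂ => F.x_apply i j (by omega) (by omega)

lemma x_apply_right_ne (i : ℤ) : F.x i (F.α (i + s)) ≠ F.α (i + s) := fun h =>
  F.x_ne_one i <| F.eq_one _ i fun j h₁ h₂ => by
    rcases eq_or_lt_of_le h₂ with rfl | h₃
    · exact h
    · exact F.x_apply i j h₁ h₃

lemma x_apply_left_ne (i : ℤ) : F.x i (F.α (i - 1)) ≠ F.α (i - 1) := fun h =>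
  F.x_ne_one i <| F.eq_one _ (i - 1) fun j h₁ h₂ => by
    rcases eq_or_lt_of_le h₁ with rfl | h₃
    · exact h
    · exact F.x_apply i j (by omega) (by omega)

lemma adj_apply {f : G ≃g G} {v w : V} (hv : f v = v) (h : G.Adj v w) : G.Adj v (f w) := by
  have := f.map_adj_iff.2 h
  rwa [hv] at this

lemma apply_ne_of_fixed {f : G ≃g G} {a b : V} (ha : f a = a) (h : b ≠ a) : f b ≠ a := fun h' =>
  h (f.injective (h'.trans ha.symm))

include F in
/-- Automorphisms that fix `v` and its neighbour `a`, and move its neighbour `b`, all move `b` to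
the third neighbour of `v`. -/
lemma apply_eq_apply {f f' : G ≃g G} {v a b : V} (hv : f v = v) (ha : f a = a) (hv' : f' v = v)
    (ha' : f' a = a) (hva : G.Adj v a) (hvb : G.Adj v b) (hab : a ≠ b) (hb : f b ≠ b)
    (hb' : f' b ≠ b) : f b = f' b :=
  F.third v a b _ _ hva hvb (adj_apply hv hvb) (adj_apply hv' hvb) hab
    (apply_ne_of_fixed ha hab.symm) hb (apply_ne_of_fixed ha' hab.symm) hb'

include F in
lemma apply_apply {f : G ≃g G} {v a b : V} (hv : f v = v) (ha : f a = a)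
    (hva : G.Adj v a) (hvb : G.Adj v b) (hab : a ≠ b) : f (f b) = b := by
  by_cases hb : f b = b
  · rw [hb, hb]
  · have hvb' := adj_apply hv hvb
    have hb' := apply_ne_of_fixed ha hab.symm
    exact F.third v a (f b) _ _ hva hvb' (adj_apply hv hvb') hvb hb'.symm
      (apply_ne_of_fixed ha hb') (fun h => hb (f.injective h)) hab.symm (Ne.symm hb)

include F in
lemma apply_eq_self {f : G ≃g G} {v a b w : V} (hv : f v = v) (ha : f a = a) (hb : f b = b)
    (hva : G.Adj v a) (hvb : G.Adj v b) (hab : a ≠ b) (hvw : G.Adj v w) : f w = w := by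
  by_cases h₁ : w = a
  · rw [h₁, ha]
  by_cases h₂ : w = b
  · rw [h₂, hb]
  exact F.third v a b _ _ hva hvb (adj_apply hv hvw) hvw hab (apply_ne_of_fixed ha h₁)
    (apply_ne_of_fixed hb h₂) h₁ h₂

lemma adj' (i : ℤ) : G.Adj (F.α i) (F.α (i - 1)) := by
  have := F.adj (i - 1)
  rw [sub_add_cancel] at this
  exact this.symm

lemma ne' (i : ℤ) : F.α (i - 1) ≠ F.α (i + 1) := by
  have := F.ne (i - 1)
  rwa [show i - 1 + 2 = i + 1 by ring] at this

lemma stab_apply_of_adj {a b i : ℤ} {f : G ≃g G} (hf : f ∈ F.stab a b) (ha : a < i) (hb : i < b)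
    {w : V} (hw : G.Adj (F.α i) w) : f w = w :=
  F.apply_eq_self (hf i ha.le hb.le) (hf (i - 1) (by omega) (by omega))
    (hf (i + 1) (by omega) (by omega)) (F.adj' i) (F.adj i) (F.ne' i) hw

lemma x_mul_self (hs : 2 ≤ s) (i : ℤ) : F.x i * F.x i = 1 := by
  refine F.eq_one _ i fun j h₁ h₂ => ?_
  rcases eq_or_lt_of_le h₂ with rfl | h₃
  · have h := F.adj (i + s - 1)
    have h' := F.ne' (i + s - 1)
    rw [sub_add_cancel] at h h'
    exact F.apply_apply (F.x_apply i _ (by omega) (by omega))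
      (F.x_apply i _ (by omega) (by omega)) (F.adj' (i + s - 1)) h h'
  · rw [RelIso.mul_apply, F.x_apply i j h₁ h₃, F.x_apply i j h₁ h₃]

lemma x_inv (hs : 2 ≤ s) (i : ℤ) : (F.x i)⁻¹ = F.x i :=
  inv_eq_of_mul_eq_one_left (F.x_mul_self hs i)

lemma x_apply_x (hs : 2 ≤ s) (i : ℤ) (v : V) : F.x i (F.x i v) = v := by
  rw [← RelIso.mul_apply, F.x_mul_self hs, RelIso.one_apply]

lemma x_mul_mem_stab_succ (hs : 2 ≤ s) {a b i : ℤ} {f : G ≃g G} (hf : f ∈ F.stab a b) (hab : a < b)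
    (hi : i + s = b + 1) (hia : i ≤ a) (h : f (F.α (b + 1)) ≠ F.α (b + 1)) :
    F.x i * f ∈ F.stab a (b + 1) := by
  have hx : F.x i ∈ F.stab a b := F.x_mem_stab hia (by omega)
  refine F.mem_stab_succ (mul_mem hx hf) ?_
  have hne := F.x_apply_right_ne i
  rw [hi] at hne
  rw [RelIso.mul_apply, F.apply_eq_apply (hf b hab.le le_rfl) (hf (b - 1) (by omega) (by omega))
    (hx b hab.le le_rfl) (hx (b - 1) (by omega) (by omega)) (F.adj' b) (F.adj b) (F.ne' b) h hne,
    F.x_apply_x hs]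

lemma x_mul_mem_stab_pred (hs : 2 ≤ s) {a b : ℤ} {f : G ≃g G} (hf : f ∈ F.stab a b) (hab : a < b)
    (hb : b < a + s) (h : f (F.α (a - 1)) ≠ F.α (a - 1)) :
    F.x a * f ∈ F.stab (a - 1) b := by
  have hx : F.x a ∈ F.stab a b := F.x_mem_stab le_rfl hb
  refine F.mem_stab_pred (mul_mem hx hf) ?_
  rw [RelIso.mul_apply, F.apply_eq_apply (hf a le_rfl hab.le) (hf (a + 1) (by omega) (by omega))
    (hx a le_rfl hab.le) (hx (a + 1) (by omega) (by omega)) (F.adj a) (F.adj' a) (F.ne' a).symm h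
    (F.x_apply_left_ne a), F.x_apply_x hs]

/-- A nontrivial `f` in the stabilizer either fixes `α (b + 1)` or does so after multiplication by
the `x c` whose last fixed vertex is `α b`; this can go on until `s + 1` vertices are fixed. -/
lemma stab_le_closure (hs : 2 ≤ s) {a b c : ℤ} (hab : a < b) (hc : c + s = b + 1) :
    F.stab a b ≤ Subgroup.closure (F.x '' Set.Icc c a) := by
  obtain ⟨n, hn⟩ : ∃ n : ℕ, a + s - b ≤ n := ⟨(a + s - b).toNat, Int.self_le_toNat _⟩
  induction n generalizing b c with
  | zero =>
    intro f hf
    rw [F.eq_one_of_mem_stab hf (by push_cast at hn; omega)]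
    exact one_mem _
  | succ n ih =>
    intro f hf
    push_cast at hn
    have hmono : Subgroup.closure (F.x '' Set.Icc (c + 1) a) ≤
        Subgroup.closure (F.x '' Set.Icc c a) :=
      Subgroup.closure_mono (Set.image_mono (Set.Icc_subset_Icc_left (by omega)))
    have key := ih (b := b + 1) (c := c + 1) (by omega) (by omega) (by omega)
    by_cases h : f (F.α (b + 1)) = F.α (b + 1)
    · exact hmono (key (F.mem_stab_succ hf h))
    by_cases hca : c ≤ a
    · have hxc : F.x c ∈ Subgroup.closure (F.x '' Set.Icc c a) :=
        Subgroup.subset_closure ⟨c, ⟨le_rfl, hca⟩, rfl⟩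
      exact (Subgroup.mul_mem_cancel_left _ hxc).1
        (hmono (key (F.x_mul_mem_stab_succ hs hf hab hc hca h)))
    · rw [F.eq_one_of_mem_stab hf (by omega)]
      exact one_mem _

lemma commute_of_mem_closure {ι M : Type*} [Group M] {u : ι → M} {S : Set ι} {y f : M}
    (h : ∀ i ∈ S, Commute (u i) y) (hf : f ∈ Subgroup.closure (u '' S)) : Commute f y := by
  have : Subgroup.closure (u '' S) ≤ Subgroup.centralizer {y} := by
    rw [Subgroup.closure_le]
    rintro _ ⟨i, hi, rfl⟩
    exact Subgroup.mem_centralizer_singleton_iff.2 (h i hi)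
  exact Subgroup.mem_centralizer_singleton_iff.1 (this hf)

/-- Jointly `x i` and `x j` fix `α j, …, α (i + s - 1)`. Their commutator fixes one vertex more at
either end, because `x i` fixes all neighbours of `α j` and `x j` all those of `α (i + s - 1)`. -/
lemma commutator_mem_stab {i j : ℤ} (hij : i < j) (hj : j ≤ i + s - 2) :
    ⁅F.x i, F.x j⁆ ∈ F.stab (j - 1) (i + s) := by
  have hi' : F.x i ∈ F.stab j (i + s - 1) := F.x_mem_stab (by omega) (by omega)
  have hj' : F.x j ∈ F.stab j (i + s - 1) := F.x_mem_stab (by omega) (by omega)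
  have h : ⁅F.x i, F.x j⁆ ∈ F.stab j (i + s - 1) := by
    rw [commutatorElement_def]
    exact mul_mem (mul_mem (mul_mem hi' hj') (inv_mem hi')) (inv_mem hj')
  -- `y` fixes every neighbour of the endpoint `v`, and hence commutes there with anything fixing `v`
  have key : ∀ (v w : V) (f y : G ≃g G), f v = v → G.Adj v w → (∀ u, G.Adj v u → y u = u) →
      f (y (f⁻¹ (y⁻¹ w))) = w ∧ y (f (y⁻¹ (f⁻¹ w))) = w := by
    intro v w f y hf hw hy
    have hf' : f⁻¹ v = v := by
      conv_lhs => rw [← hf]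
      exact RelIso.inv_apply_self _ _
    have hy' : ∀ u, G.Adj v u → y⁻¹ u = u := fun u hu => by
      conv_lhs => rw [← hy u hu]
      exact RelIso.inv_apply_self _ _
    constructor
    · rw [hy' w hw, hy _ (adj_apply hf' hw), RelIso.apply_inv_self]
    · rw [hy' _ (adj_apply hf' hw), RelIso.apply_inv_self, hy w hw]
  have h₁ := F.adj (i + s - 1)
  rw [sub_add_cancel] at h₁
  have h₂ : ⁅F.x i, F.x j⁆ ∈ F.stab j (i + s - 1 + 1) := F.mem_stab_succ h <| by
    rw [sub_add_cancel]
    refine (key _ _ (F.x i) (F.x j) (hi' _ (by omega) le_rfl) h₁ fun u hu => ?_).1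
    exact F.stab_apply_of_adj (F.x_mem_stab (a := j) (b := i + s) (by omega) (by omega))
      (by omega) (by omega) hu
  rw [sub_add_cancel] at h₂
  refine F.mem_stab_pred h₂ ?_
  refine (key _ _ (F.x j) (F.x i) (hj' _ le_rfl (by omega)) (F.adj' j) fun u hu => ?_).2
  exact F.stab_apply_of_adj (F.x_mem_stab (a := i) (b := i + s - 1) (by omega) (by omega))
    (by omega) (by omega) hu

lemma x_add (i : ℤ) (n : ℤ) : F.x (i + n) = F.g ^ n * F.x i * (F.g ^ n)⁻¹ := by
  induction n using Int.induction_on with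
  | zero => simp
  | succ n ih => rw [← add_assoc, F.x_succ, ih, zpow_add_one, zpow_natCast]; group
  | pred n ih =>
    have h := F.x_succ (i + (-n - 1))
    rw [show i + (-(n : ℤ) - 1) + 1 = i + -n by ring, ih] at h
    have h' : F.x (i + (-n - 1)) = F.g⁻¹ * (F.g * F.x (i + (-n - 1)) * F.g⁻¹) * F.g := by group
    rw [h', ← h]
    group

lemma commute_x_add (i j n : ℤ) : Commute (F.x (i + n)) (F.x (j + n)) ↔ Commute (F.x i) (F.x j) := by
  rw [F.x_add i, F.x_add j, Commute.conj_iff]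

lemma exists_apply_eq_right (hs : 2 ≤ s) (i : ℤ) {w : V} (hw : G.Adj (F.α i) w) :
    ∃ t ∈ Subgroup.closure {F.x (i + 1 - s), F.x i}, t w = F.α (i + 1) := by
  have ha : F.x (i + 1 - s) ∈ Subgroup.closure {F.x (i + 1 - s), F.x i} :=
    Subgroup.subset_closure (by simp)
  have hb : F.x i ∈ Subgroup.closure {F.x (i + 1 - s), F.x i} :=
    Subgroup.subset_closure (by simp)
  have hn := F.ne' i
  have h₁ : F.x (i + 1 - s) (F.α (i + 1)) ≠ F.α (i + 1) := by
    simpa using F.x_apply_right_ne (i + 1 - s)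
  have h₂ : F.x (i + 1 - s) (F.α i) = F.α i := F.x_apply _ _ (by omega) (by omega)
  have h₃ : F.x (i + 1 - s) (F.α (i - 1)) = F.α (i - 1) := F.x_apply _ _ (by omega) (by omega)
  have h₄ : F.x i (F.α i) = F.α i := F.x_apply _ _ (by omega) (by omega)
  have h₅ : F.x i (F.α (i + 1)) = F.α (i + 1) := F.x_apply _ _ (by omega) (by omega)
  have hthird : ∀ u, G.Adj (F.α i) u → u ≠ F.α (i - 1) → u ≠ F.α (i + 1) →
      F.x (i + 1 - s) u = F.α (i + 1) := fun u hu hu₁ hu₂ => by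
    rw [F.third (F.α i) (F.α (i - 1)) (F.α (i + 1)) u _ (F.adj' i) (F.adj i) hu
      (adj_apply h₂ (F.adj i)) hn hu₁ hu₂ (apply_ne_of_fixed h₃ hn.symm) h₁, F.x_apply_x hs]
  by_cases hw₁ : w = F.α (i + 1)
  · exact ⟨1, one_mem _, hw₁⟩
  by_cases hw₂ : w = F.α (i - 1)
  · refine ⟨F.x (i + 1 - s) * F.x i, mul_mem ha hb, ?_⟩
    rw [hw₂, RelIso.mul_apply]
    exact hthird _ (adj_apply h₄ (F.adj' i)) (F.x_apply_left_ne i) (apply_ne_of_fixed h₅ hn)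
  · exact ⟨_, ha, hthird w hw hw₂ hw₁⟩

lemma exists_apply_eq_left (hs : 2 ≤ s) (i : ℤ) {w : V} (hw : G.Adj (F.α i) w) :
    ∃ t ∈ Subgroup.closure {F.x (i + 1 - s), F.x i}, t w = F.α (i - 1) := by
  have h := F.reverse.exists_apply_eq_right hs (-i) (w := w)
  simp only [ArcFrame.reverse] at h
  rw [neg_neg, show 1 - s - (-i + 1 - s) = i by ring, show 1 - s - -i = i + 1 - s by ring,
    show -(-i + 1) = i - 1 by ring, Set.pair_comm] at h
  exact h hw

/-- An `x k` commuting with `x 0, …, x s` would have its fixed points permuted by the group that they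
generate, under which each vertex is equivalent to `α (s - 1)` or to `α s`. -/
lemma exists_not_commute (hconn : G.Preconnected) (hs : 2 ≤ s) {k : ℤ} (hk : 1 ≤ k)
    (hks : k < s) : ∃ i, 0 ≤ i ∧ i ≤ s ∧ ¬ Commute (F.x i) (F.x k) := by
  by_contra! h
  set T := Subgroup.closure (F.x '' Set.Icc 0 s) with hT
  have hpair : ∀ i j, 0 ≤ i → i ≤ s → 0 ≤ j → j ≤ s →
      Subgroup.closure {F.x i, F.x j} ≤ T := fun i j h₁ h₂ h₃ h₄ => Subgroup.closure_mono <| by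
    rintro _ (rfl | rfl)
    · exact ⟨i, ⟨h₁, h₂⟩, rfl⟩
    · exact ⟨j, ⟨h₃, h₄⟩, rfl⟩
  have hcov : ∀ v : V, ∃ t ∈ T, v = t (F.α (s - 1)) ∨ v = t (F.α s) := by
    have hstep : ∀ v w : V, G.Adj v w → (∃ t ∈ T, v = t (F.α (s - 1)) ∨ v = t (F.α s)) →
        ∃ t ∈ T, w = t (F.α (s - 1)) ∨ w = t (F.α s) := by
      rintro v w hvw ⟨t, ht, rfl | rfl⟩ <;> obtain ⟨w, rfl⟩ := t.surjective w
      · obtain ⟨t', ht', h'⟩ := F.exists_apply_eq_right hs (s - 1) (t.map_adj_iff.1 hvw)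
        refine ⟨t * t'⁻¹, mul_mem ht (inv_mem (hpair _ _ (by omega) (by omega) (by omega)
          (by omega) ht')), Or.inr ?_⟩
        rw [sub_add_cancel] at h'
        rw [← h', RelIso.mul_apply, RelIso.inv_apply_self]
      · obtain ⟨t', ht', h'⟩ := F.exists_apply_eq_left hs s (t.map_adj_iff.1 hvw)
        refine ⟨t * t'⁻¹, mul_mem ht (inv_mem (hpair _ _ (by omega) (by omega) (by omega)
          (by omega) ht')), Or.inl ?_⟩
        rw [← h', RelIso.mul_apply, RelIso.inv_apply_self]
    intro v
    obtain ⟨p⟩ := hconn v (F.α s)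
    have hwalk : ∀ u w : V, G.Walk u w → (∃ t ∈ T, w = t (F.α (s - 1)) ∨ w = t (F.α s)) →
        ∃ t ∈ T, u = t (F.α (s - 1)) ∨ u = t (F.α s) := by
      intro u w p hw
      induction p with
      | nil => exact hw
      | cons h p ih => exact hstep _ _ h.symm (ih hw)
    exact hwalk _ _ p ⟨1, one_mem _, Or.inr rfl⟩
  refine F.x_ne_one k (RelIso.ext fun v => ?_)
  obtain ⟨t, ht, hv⟩ := hcov v
  have hc : Commute t (F.x k) := commute_of_mem_closure (fun i hi => h i hi.1 hi.2) ht
  have : ∀ u, F.x k u = u → F.x k (t u) = t u := fun u hu => by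
    rw [← RelIso.mul_apply, ← hc.eq, RelIso.mul_apply, hu]
  rcases hv with rfl | rfl
  · exact this _ (F.x_apply _ _ (by omega) (by omega))
  · exact this _ (F.x_apply _ _ (by omega) (by omega))

/-! ### The least non-commuting distance -/

/-- `m` is the least positive distance between the indices of two `x i` that do not commute. By
translation, whether `x i` and `x j` commute depends on `j - i` only. -/
structure IsCommGap (m : ℤ) : Prop where
  pos : 0 < m
  commute : ∀ i j, i < j + m → j < i + m → Commute (F.x i) (F.x j)
  not_commute : ∀ i, ¬ Commute (F.x i) (F.x (i + m))

lemma exists_isCommGap (hconn : G.Preconnected) (hs : 3 ≤ s) :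
    ∃ m, F.IsCommGap m ∧ 2 * m ≤ s + 1 := by
  classical
  have hex : ∃ n : ℕ, 0 < n ∧ 2 * (n : ℤ) ≤ s + 1 ∧ ¬ Commute (F.x 0) (F.x n) := by
    obtain ⟨i, h0, h1, h2⟩ := F.exists_not_commute hconn (by omega) (k := (s + 1) / 2)
      (by omega) (by omega)
    rcases lt_trichotomy i ((s + 1) / 2) with h | h | h
    · refine ⟨((s + 1) / 2 - i).toNat, by omega, by omega, fun hc => h2 ?_⟩
      rw [Int.toNat_of_nonneg (by omega)] at hc
      have := (F.commute_x_add 0 ((s + 1) / 2 - i) i).2 hc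
      rwa [zero_add, sub_add_cancel] at this
    · exact absurd (by rw [h]) h2
    · refine ⟨(i - (s + 1) / 2).toNat, by omega, by omega, fun hc => h2 ?_⟩
      rw [Int.toNat_of_nonneg (by omega)] at hc
      have := (F.commute_x_add 0 (i - (s + 1) / 2) ((s + 1) / 2)).2 hc
      rw [zero_add, sub_add_cancel] at this
      exact this.symm
  obtain ⟨hpos, hle, hnc⟩ := Nat.find_spec hex
  have hmin := fun n => Nat.find_min (H := hex) (m := n)
  generalize Nat.find hex = m at hpos hle hnc hmin
  have hlt : ∀ i j : ℤ, i < j → j < i + m → Commute (F.x i) (F.x j) := fun i j h₁ h₂ => by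
    have h := hmin (j - i).toNat (by omega)
    push Not at h
    have h' := h (by omega) (by omega)
    rw [Int.toNat_of_nonneg (by omega)] at h'
    have := (F.commute_x_add 0 (j - i) i).2 h'
    rwa [zero_add, sub_add_cancel] at this
  refine ⟨m, ⟨by omega, fun i j h₁ h₂ => ?_, fun i h => hnc ?_⟩, hle⟩
  · rcases lt_trichotomy i j with h | rfl | h
    · exact hlt i j h h₂
    · exact Commute.refl _
    · exact (hlt j i h h₁).symm
  · have := (F.commute_x_add 0 m i).1
    rw [zero_add, add_comm] at this
    exact this h

variable {F}

lemma IsCommGap.reverse {m : ℤ} (h : F.IsCommGap m) : F.reverse.IsCommGap m where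
  pos := h.pos
  commute i j h₁ h₂ := h.commute _ _ (by omega) (by omega)
  not_commute i hc := h.not_commute (1 - s - (i + m)) <| by
    have := hc.symm
    simp only [ArcFrame.reverse] at this
    rwa [show 1 - s - (i + m) + m = 1 - s - i by ring]

/-- As `y * a * y⁻¹ = a * ⁅a⁻¹, y⁆`, conjugation by `y` only changes `a` by a factor that commutes
with `b`. -/
lemma commute_commutator {M : Type*} [Group M] {a b y : M} (hb : Commute b y)
    (h : Commute ⁅a⁻¹, y⁆ b) : Commute ⁅a, b⁆ y := by
  have h₁ : y * b * y⁻¹ = b := by rw [← hb.eq, mul_inv_cancel_right]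
  have h₂ : ⁅a⁻¹, y⁆ * b * ⁅a⁻¹, y⁆⁻¹ = b := by rw [h.eq, mul_inv_cancel_right]
  have h₃ : y * ⁅a, b⁆ * y⁻¹ =
      a * (⁅a⁻¹, y⁆ * (y * b * y⁻¹) * ⁅a⁻¹, y⁆⁻¹) * a⁻¹ * (y * b * y⁻¹)⁻¹ := by
    simp only [commutatorElement_def]
    group
  rw [h₁, h₂, ← commutatorElement_def, mul_inv_eq_iff_eq_mul] at h₃
  exact h₃.symm

/-- The fixed stretch is prolonged by one vertex at a time. If the commutator did not fix
`α (i + s + n + 1)`, then multiplying it by `x (i + n + 1)` would leave a product of `x j` with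
`i + n + 1 < j < i + m`. All of these commute with `x (i + n + 1 + m)`, and so does the
commutator, by `commute_commutator`; but `x (i + n + 1)` does not. -/
lemma IsCommGap.commutator_mem_stab_right {m : ℤ} (hm : F.IsCommGap m) (hms : m ≤ s - 2) (i : ℤ) :
    ⁅F.x i, F.x (i + m)⁆ ∈ F.stab (i + m - 1) (i + 2 * s - m - 2) := by
  have hpos := hm.pos
  have key : ∀ n : ℕ, n ≤ s - 2 - m →
      ⁅F.x i, F.x (i + m)⁆ ∈ F.stab (i + m - 1) (i + s + n) := by
    intro n
    induction n with
    | zero =>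
      intro _
      simpa using F.commutator_mem_stab (i := i) (j := i + m) (by omega) (by omega)
    | succ n ih =>
      intro hn
      push_cast at hn ⊢
      have hc := ih (by omega)
      by_cases hnm : m ≤ n + 1
      · rw [F.eq_one_of_mem_stab hc (by omega)]
        exact one_mem _
      rw [← add_assoc]
      by_contra hcon
      have hne : ⁅F.x i, F.x (i + m)⁆ (F.α (i + s + n + 1)) ≠ F.α (i + s + n + 1) :=
        fun h => hcon (F.mem_stab_succ hc h)
      have h₁ := F.x_mul_mem_stab_succ (by omega) hc (by omega) (i := i + n + 1) (by omega)
        (by omega) hne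
      set y := F.x (i + n + 1 + m) with hy
      have h₂ : Commute (F.x (i + n + 1) * ⁅F.x i, F.x (i + m)⁆) y :=
        commute_of_mem_closure (fun j hj => hm.commute _ _ (by have := hj.2; omega)
          (by have := hj.1; omega))
          (F.stab_le_closure (by omega) (by omega) (c := i + n + 2) (by omega) h₁)
      have h₃ : Commute (F.x (i + m)) y := hm.commute _ _ (by omega) (by omega)
      have h₄ : Commute ⁅F.x i, y⁆ (F.x (i + m)) :=
        commute_of_mem_closure (fun j hj => hm.commute _ _ (by have := hj.2; omega)
          (by have := hj.1; omega))
          (F.stab_le_closure (by omega) (by omega) (c := i + 1) (by omega)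
            (F.commutator_mem_stab (i := i) (j := i + n + 1 + m) (by omega) (by omega)))
      have h₅ : Commute ⁅F.x i, F.x (i + m)⁆ y := by
        refine commute_commutator h₃ ?_
        rwa [F.x_inv (by omega)]
      have h₆ : Commute (F.x (i + n + 1)) y := by
        have := h₂.mul_left h₅.inv_left
        rwa [mul_inv_cancel_right] at this
      exact hm.not_commute _ h₆
  have := key (s - 2 - m).toNat (by omega)
  rwa [Int.toNat_of_nonneg (by omega), show i + s + (s - 2 - m) = i + 2 * s - m - 2 by ring] at this

lemma IsCommGap.commutator_mem_stab_left {m : ℤ} (hm : F.IsCommGap m) (hms : m ≤ s - 2) (i : ℤ) :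
    ⁅F.x i, F.x (i + m)⁆ ∈ F.stab (i + 2 * m - s + 1) (i + s) := by
  have h := hm.reverse.commutator_mem_stab_right hms (1 - s - i - m)
  rw [← commutatorElement_inv, inv_mem_iff]
  intro j h₁ h₂
  have := h (-j) (by omega) (by omega)
  simp only [ArcFrame.reverse] at this
  rwa [neg_neg, show 1 - s - (1 - s - i - m) = i + m by ring,
    show 1 - s - (1 - s - i - m + m) = i by ring] at this

lemma IsCommGap.two_mul_sub_two_le {m : ℤ} (hm : F.IsCommGap m) (hms : m ≤ s - 2) :
    2 * s - 2 ≤ 3 * m := by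
  by_contra hlt
  refine hm.not_commute 0 (commutatorElement_eq_one_iff_commute.1 ?_)
  refine F.eq_one_of_mem_stab (a := 2 * m - s + 1) (b := 2 * s - m - 2) (fun j h₁ h₂ => ?_)
    (by omega)
  rcases le_total j s with h | h
  · exact hm.commutator_mem_stab_left hms 0 j (by omega) (by omega)
  · exact hm.commutator_mem_stab_right hms 0 j (by omega) (by omega)

lemma sq_eq_one_of_mem_closure {M : Type*} [Group M] {S : Set M} (h : ∀ a ∈ S, a * a = 1)
    (hc : ∀ a ∈ S, ∀ b ∈ S, Commute a b) {n : M} (hn : n ∈ Subgroup.closure S) : n * n = 1 := by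
  have hcomm : ∀ a ∈ Subgroup.closure S, ∀ b ∈ Subgroup.closure S, Commute a b := by
    intro a ha b hb
    have h₁ : ∀ c ∈ S, Commute a c := fun c hcS =>
      commute_of_mem_closure (u := id) (S := S) (fun d hd => hc d hd c hcS) (by simpa using ha)
    exact (commute_of_mem_closure (u := id) (S := S) (fun d hd => (h₁ d hd).symm)
      (by simpa using hb)).symm
  induction hn using Subgroup.closure_induction with
  | mem a ha => exact h a ha
  | one => exact one_mul 1
  | mul a b ha hb iha ihb =>
    rw [(hcomm b hb a ha).mul_mul_mul_comm, iha, ihb, one_mul]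
  | inv a ha iha => rw [← mul_inv_rev, iha, inv_one]

/-! ### The bound on the length -/

lemma not_isCommGap_four (F : ArcFrame G 7) : ¬ F.IsCommGap 4 := by
  intro hm
  have hxx := F.x_mul_self (by norm_num)
  have h16 : ⁅F.x 1, F.x 6⁆ ∈ F.stab 5 8 :=
    F.commutator_mem_stab (i := 1) (j := 6) (by norm_num) (by norm_num)
  -- If the commutator moved `α 4`, it would be `x 5 * n` with `n` in the elementary abelian group
  -- generated by `x 2, x 3, x 4`, which commutes with `x 1` and `x 5`. The conjugate
  -- `x 1 * (x 5 * n)` of `x 1` is an involution, so that `x 1 * x 5` would be one as well, and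
  -- `x 1` and `x 5` would commute.
  have h16' : ⁅F.x 1, F.x 6⁆ ∈ F.stab 4 8 := by
    by_contra hcon
    have hn := F.x_mul_mem_stab_pred (by norm_num) h16 (by norm_num) (by norm_num)
      (fun h => hcon (F.mem_stab_pred h16 h))
    norm_num at hn
    have hcl := F.stab_le_closure (by norm_num) (by norm_num) (c := 2) (by norm_num) hn
    set n := F.x 5 * ⁅F.x 1, F.x 6⁆ with hdef
    have hn1 : Commute n (F.x 1) := commute_of_mem_closure (fun j hj => hm.commute _ _
      (by have := hj.2; omega) (by have := hj.1; omega)) hcl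
    have hn5 : Commute n (F.x 5) := commute_of_mem_closure (fun j hj => hm.commute _ _
      (by have := hj.2; omega) (by have := hj.1; omega)) hcl
    have hnn : n * n = 1 := sq_eq_one_of_mem_closure
      (by rintro _ ⟨i, hi, rfl⟩; exact hxx i)
      (by
        rintro _ ⟨i, hi, rfl⟩ _ ⟨j, hj, rfl⟩
        obtain ⟨_, _⟩ := hi
        obtain ⟨_, _⟩ := hj
        exact hm.commute _ _ (by omega) (by omega)) hcl
    refine hm.not_commute 1 ?_
    have h₁ : F.x 1 * ⁅F.x 1, F.x 6⁆ * (F.x 1 * ⁅F.x 1, F.x 6⁆) = 1 := by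
      have : F.x 1 * ⁅F.x 1, F.x 6⁆ = (F.x 1 * F.x 1) * (F.x 6 * (F.x 1)⁻¹ * (F.x 6)⁻¹) := by
        rw [commutatorElement_def]
        group
      have hc : ∀ i f, F.x i * (F.x i * f) = f := fun i f => by rw [← mul_assoc, hxx, one_mul]
      rw [this, hxx, one_mul, F.x_inv (by norm_num), F.x_inv (by norm_num)]
      simp only [mul_assoc, hc, hxx]
    have h₂ : ⁅F.x 1, F.x 6⁆ = F.x 5 * n := by rw [hdef, ← mul_assoc, hxx, one_mul]
    rw [h₂, ← mul_assoc (F.x 1) (F.x 5) n, (hn1.mul_right hn5).mul_mul_mul_comm, hnn, mul_one] at h₁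
    have h₃ := eq_inv_of_mul_eq_one_left h₁
    rw [mul_inv_rev, F.x_inv (by norm_num), F.x_inv (by norm_num)] at h₃
    exact h₃
  have h26 : ⁅F.x 2, F.x 6⁆ ∈ F.stab 4 7 :=
    F.stab_mono (by norm_num) (by norm_num) (hm.commutator_mem_stab_left (by norm_num) 2)
  have hx6 : ∀ f ∈ F.stab 4 7, F.x 6 * f * (F.x 6)⁻¹ ∈ F.stab 4 7 := by
    have hle : Subgroup.closure (F.x '' Set.Icc 1 4) ≤
        (F.stab 4 7).comap (MulAut.conj (F.x 6)).toMonoidHom := by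
      rw [Subgroup.closure_le]
      rintro _ ⟨i, ⟨h1, h4⟩, rfl⟩
      have hi : F.x i ∈ F.stab 4 7 := F.x_mem_stab h4 (by omega)
      suffices ⁅F.x i, F.x 6⁆ ∈ F.stab 4 7 by
        have h := mul_mem (inv_mem this) hi
        rw [commutatorElement_inv, commutatorElement_def, inv_mul_cancel_right] at h
        exact h
      obtain rfl | rfl | h : i = 1 ∨ i = 2 ∨ 3 ≤ i := by omega
      · exact F.stab_mono le_rfl (by norm_num) h16'
      · exact h26
      · rw [commutatorElement_eq_one_iff_commute.2 (hm.commute i 6 (by omega) (by omega))]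
        exact one_mem _
    exact fun f hf => hle (F.stab_le_closure (by norm_num) (by norm_num) (by norm_num) hf)
  have hx0 : ∀ f ∈ F.stab 4 7, F.x 0 * f * (F.x 0)⁻¹ ∈ F.stab 4 7 := by
    intro f hf j h₁ h₂
    have h0 : (F.x 0)⁻¹ ∈ F.stab 0 6 := inv_mem (F.x_mem_stab le_rfl (by norm_num))
    have hfj : f ((F.x 0)⁻¹ (F.α j)) = (F.x 0)⁻¹ (F.α j) := by
      rcases eq_or_lt_of_le h₂ with rfl | h₃
      · exact F.stab_apply_of_adj hf (by norm_num) (by norm_num)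
          (adj_apply (h0 6 (by norm_num) le_rfl) (F.adj 6))
      · rw [h0 j (by omega) (by omega), hf j h₁ h₂]
    rw [RelIso.mul_apply, RelIso.mul_apply, hfj, RelIso.apply_inv_self]
  -- `y` turns `α 5, α 6` into `α 7, α 6`. Hence it maps `α 4, …, α 7` to vertices near `α 6` and
  -- `α 7` that `x 5` fixes, and `y⁻¹ * x 5 * y` lies in the stabilizer of `α 4, …, α 7`.
  set y := F.x 0 * F.x 6 with hy
  have e06 : F.x 0 (F.α 6) = F.α 6 := F.x_apply _ _ (by norm_num) (by norm_num)
  have e66 : F.x 6 (F.α 6) = F.α 6 := F.x_apply _ _ (by norm_num) (by norm_num)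
  have hy6 : y (F.α 6) = F.α 6 := by rw [hy, RelIso.mul_apply, e66, e06]
  have hy5 : y (F.α 5) = F.α 7 := by
    have h57 : F.α 5 ≠ F.α 7 := F.ne 5
    have : F.x 6 (F.α 5) = F.x 0 (F.α 7) :=
      F.third (F.α 6) (F.α 5) (F.α 7) _ _ (F.adj' 6) (F.adj 6) (adj_apply e66 (F.adj' 6))
        (adj_apply e06 (F.adj 6)) h57 (F.x_apply_left_ne 6)
        (apply_ne_of_fixed (F.x_apply _ _ (by norm_num) (by norm_num)) h57)
        (apply_ne_of_fixed (F.x_apply _ _ (by norm_num) (by norm_num)) h57.symm)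
        (F.x_apply_right_ne 0)
    rw [hy, RelIso.mul_apply, this, F.x_apply_x (by norm_num)]
  have h5 : F.x 5 ∈ F.stab 5 11 := F.x_mem_stab le_rfl (by norm_num)
  have hz : y⁻¹ * F.x 5 * y ∈ F.stab 4 7 := by
    intro j h₁ h₂
    suffices F.x 5 (y (F.α j)) = y (F.α j) by
      rw [RelIso.mul_apply, RelIso.mul_apply, this, RelIso.inv_apply_self]
    obtain rfl | rfl | rfl | rfl : j = 4 ∨ j = 5 ∨ j = 6 ∨ j = 7 := by omega
    · refine F.stab_apply_of_adj h5 (i := 7) (by norm_num) (by norm_num) ?_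
      rw [← hy5]
      exact y.map_adj_iff.2 (F.adj' 5)
    · rw [hy5]
      exact h5 7 (by norm_num) (by norm_num)
    · rw [hy6]
      exact h5 6 (by norm_num) (by norm_num)
    · exact F.stab_apply_of_adj h5 (i := 6) (by norm_num) (by norm_num)
        (adj_apply hy6 (F.adj 6))
  have h := hx0 _ (hx6 _ hz)
  rw [show F.x 0 * (F.x 6 * (y⁻¹ * F.x 5 * y) * (F.x 6)⁻¹) * (F.x 0)⁻¹ = F.x 5 by
    rw [hy]; group] at h
  exact F.x_apply_left_ne 5 (h 4 le_rfl (by norm_num))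

/-- Tutte's bound. -/
theorem le_five (F : ArcFrame G s) (hconn : G.Preconnected) : s ≤ 5 := by
  by_contra! hs
  obtain ⟨m, hm, hle⟩ := F.exists_isCommGap hconn (by omega)
  have h := hm.two_mul_sub_two_le (by omega)
  obtain rfl : s = 7 := by omega
  obtain rfl : m = 4 := by omega
  exact not_isCommGap_four F hm

end ArcFrame

/-! ### Arc frames of regular cubic graphs -/

lemma IsRegularOfDegree.eq_of_adj [G.LocallyFinite] (h : G.IsRegularOfDegree 3) {v a b c d : V}
    (ha : G.Adj v a) (hb : G.Adj v b) (hc : G.Adj v c) (hd : G.Adj v d) (hab : a ≠ b)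
    (hca : c ≠ a) (hcb : c ≠ b) (hda : d ≠ a) (hdb : d ≠ b) : c = d := by
  classical
  by_contra hcd
  have hle : ({a, b, c, d} : Finset V) ⊆ G.neighborFinset v := by
    intro w hw
    simp only [Finset.mem_insert, Finset.mem_singleton] at hw
    rw [mem_neighborFinset]
    rcases hw with rfl | rfl | rfl | rfl <;> assumption
  have hcard := Finset.card_le_card hle
  rw [card_neighborFinset_eq_degree, h v, Finset.card_eq_succ.2 ⟨a, {b, c, d}, by
    simp [hab, hca.symm, hda.symm], rfl, Finset.card_eq_three.2
      ⟨b, c, d, hcb.symm, hdb.symm, hcd, rfl⟩⟩] at hcard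
  omega

lemma IsRegularOfDegree.exists_adj_ne [G.LocallyFinite] (h : G.IsRegularOfDegree 3) (v a b : V) :
    ∃ c, G.Adj v c ∧ c ≠ a ∧ c ≠ b := by
  classical
  by_contra! hcon
  have hle : G.neighborFinset v ⊆ {a, b} := fun c hc => by
    rw [mem_neighborFinset] at hc
    by_cases hca : c = a
    · simp [hca]
    · simp [hcon c hc hca]
  have := (Finset.card_le_card hle).trans Finset.card_le_two
  rw [card_neighborFinset_eq_degree, h v] at this
  omega

lemma isArc_of_nat {s : ℕ} {a : ℕ → V} (hadj : ∀ i < s, G.Adj (a i) (a (i + 1)))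
    (hne : ∀ i, i + 2 ≤ s → a i ≠ a (i + 2)) : G.IsArc s fun i => a i where
  adj i := hadj i i.isLt
  ne i hi := hne i (by omega)

/-- An `s`-arc can be prolonged by one vertex. It is reindexed by `ℕ`, with irrelevant values beyond
index `s + 1`. -/
lemma IsArc.exists_nat_extension [G.LocallyFinite] (hG : G.IsRegularOfDegree 3) {s : ℕ}
    {p : Fin (s + 1) → V} (hp : G.IsArc s p) : ∃ a : ℕ → V,
      (∀ i ≤ s, G.Adj (a i) (a (i + 1))) ∧ ∀ i, i + 2 ≤ s + 1 → a i ≠ a (i + 2) := by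
  -- The truncated `s - 1` only matters for `s ≥ 1`: there is nothing to avoid when `s = 0`.
  obtain ⟨w, hw, hw', -⟩ := hG.exists_adj_ne (p (Fin.last s)) (p ⟨s - 1, by omega⟩)
    (p ⟨s - 1, by omega⟩)
  refine ⟨fun i => if h : i < s + 1 then p ⟨i, h⟩ else w, fun i hi => ?_, fun i hi => ?_⟩
  · rcases hi.lt_or_eq with h | rfl
    · simpa [h, Nat.lt_succ_of_lt h] using hp.adj ⟨i, h⟩
    · simp only [lt_add_iff_pos_right, Nat.lt_one_iff, dite_true, lt_irrefl, dite_false]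
      exact hw
  · rcases hi.lt_or_eq with h | h
    · simpa [show i < s + 1 by omega, show i + 2 < s + 1 by omega] using hp.ne i (by omega)
    · obtain rfl : s = i + 1 := by omega
      simpa using hw'.symm

theorem IsArcRegular.nonempty_arcFrame [G.LocallyFinite] (hG : G.IsRegularOfDegree 3) {s : ℕ}
    (hs : G.IsArcRegular s) (h2 : 2 ≤ s) : Nonempty (ArcFrame G s) := by
  obtain ⟨⟨⟨p, hp⟩, htrans⟩, huniq⟩ := hs
  obtain ⟨a, hadj, hne⟩ := hp.exists_nat_extension hG
  have ha : G.IsArc s fun i => a i :=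
    isArc_of_nat (fun i hi => hadj i hi.le) fun i hi => hne i (by omega)
  obtain ⟨g, hg⟩ := htrans _ _ ha (isArc_of_nat (a := fun i => a (i + 1))
    (fun i hi => hadj (i + 1) hi) fun i hi => by simpa [add_right_comm] using hne (i + 1) (by omega))
  replace hg : ∀ i ≤ s, g (a i) = a (i + 1) := fun i hi => hg ⟨i, by omega⟩
  -- `x 0` is the automorphism that replaces the last vertex of the arc by its only alternative `c`.
  obtain ⟨c, hc, hc₁, hc₂⟩ := hG.exists_adj_ne (a (s - 1)) (a (s - 2)) (a s)
  obtain ⟨f, hf⟩ := htrans _ _ ha (isArc_of_nat (a := Function.update a s c)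
    (fun i hi => by
      rw [Function.update_of_ne hi.ne]
      rcases eq_or_ne (i + 1) s with h | h
      · rw [h, Function.update_self, show i = s - 1 by omega]
        exact hc
      · rw [Function.update_of_ne h]
        exact hadj i hi.le)
    fun i hi => by
      rw [Function.update_of_ne (by omega)]
      rcases eq_or_ne (i + 2) s with h | h
      · rw [h, Function.update_self, show i = s - 2 by omega]
        exact hc₁.symm
      · rw [Function.update_of_ne h]
        exact hne i (by omega))
  have hf₁ : ∀ i < s, f (a i) = a i := fun i hi => by
    have := hf ⟨i, by omega⟩
    simpa [hi.ne] using this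
  have hf₂ : f (a s) ≠ a s := by
    have := hf (Fin.last s)
    simp only [Fin.val_last, Function.update_self] at this
    rwa [this]
  have hgn : ∀ i : ℕ, i ≤ s + 1 → (g ^ i) (a 0) = a i := by
    intro i
    induction i with
    | zero => intro _; rfl
    | succ i ih =>
      intro hi
      rw [pow_succ', RelIso.mul_apply, ih (by omega), hg i (by omega)]
  have hgz : ∀ (i : ℤ) (k : ℕ), k ≤ s + 1 → (g ^ (i + k)) (a 0) = (g ^ i) (a k) := by
    intro i k hk
    rw [zpow_add, RelIso.mul_apply, zpow_natCast, hgn k hk]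
  have hαadj : ∀ i : ℤ, G.Adj ((g ^ i) (a 0)) ((g ^ (i + 1)) (a 0)) := fun i => by
    have := hgz i 1 (by omega)
    push_cast at this
    rw [this]
    exact (g ^ i).map_adj_iff.2 (hadj 0 (by omega))
  have hαne : ∀ i : ℤ, (g ^ i) (a 0) ≠ (g ^ (i + 2)) (a 0) := fun i h => by
    have := hgz i 2 (by omega)
    push_cast at this
    rw [this] at h
    exact hne 0 (by omega) ((g ^ i).injective h)
  exact ⟨{
    g := g
    α := fun i => (g ^ i) (a 0)
    x := fun i => g ^ i * f * (g ^ i)⁻¹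
    g_apply := fun i => by rw [add_comm, zpow_add, zpow_one, RelIso.mul_apply]
    adj := hαadj
    ne := hαne
    x_apply := fun i j h₁ h₂ => by
      obtain ⟨k, rfl⟩ := Int.le.dest h₁
      rw [hgz i k (by omega), RelIso.mul_apply, RelIso.inv_apply_self, RelIso.mul_apply,
        hf₁ k (by omega)]
    x_ne_one := fun i h => hf₂ <| by
      rw [mul_inv_eq_one, mul_eq_left] at h
      rw [h, RelIso.one_apply]
    x_succ := fun i => by rw [add_comm, zpow_add, zpow_one]; group
    third := fun v a b c d => hG.eq_of_adj
    eq_one := fun f i h => by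
      have hq : G.IsArc s fun k => (fun n : ℕ => (g ^ (i + n)) (a 0)) k :=
        isArc_of_nat (a := fun n : ℕ => (g ^ (i + n)) (a 0)) (fun k _ => by
          push_cast
          rw [← add_assoc]
          exact hαadj (i + k))
          fun k _ => by
          push_cast
          rw [← add_assoc]
          exact hαne (i + k)
      exact huniq _ _ hq hq f 1 (fun k => h _ (by omega) (by omega)) fun k => rfl }⟩

/-! ### Counting arcs -/

section Counting

variable [Fintype V]

open Classical in
/-- If `N r` contains the last vertex of each prolongation of the `n`-arc `r` and has at most `k`
elements, then there are at most `k` times as many `(n + 1)`-arcs as `n`-arcs. -/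
lemma card_isArc_succ_le {n k : ℕ} (N : (Fin (n + 1) → V) → Finset V)
    (hN : ∀ q, G.IsArc (n + 1) q → q (Fin.last _) ∈ N (q ∘ Fin.castSucc))
    (hk : ∀ r, G.IsArc n r → (N r).card ≤ k) :
    (Finset.univ.filter (G.IsArc (n + 1))).card ≤ k * (Finset.univ.filter (G.IsArc n)).card := by
  refine Finset.card_le_mul_card_image_of_maps_to (f := fun q => q ∘ Fin.castSucc)
    (fun q hq => ?_) k fun r hr => ?_
  · simp only [Finset.mem_filter, Finset.mem_univ, true_and] at hq ⊢
    exact ⟨fun i => hq.adj i.castSucc, fun i hi => hq.ne i (by omega)⟩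
  · simp only [Finset.mem_filter, Finset.mem_univ, true_and] at hr
    refine (Finset.card_le_card_of_injOn (fun q => q (Fin.last _)) (fun q hq => ?_) ?_).trans (hk r hr)
    · simp only [Finset.mem_filter, Finset.mem_univ, true_and, Finset.coe_filter,
        Set.mem_ofPred_eq] at hq
      rw [← hq.2]
      exact hN q hq.1
    · intro q hq q' hq' h
      simp only [Finset.mem_filter, Finset.mem_univ, true_and, Finset.coe_filter,
        Set.mem_ofPred_eq] at hq hq'
      funext i
      refine Fin.lastCases h (fun j => ?_) i
      exact congrFun (hq.2.trans hq'.2.symm) j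

open Classical in
lemma card_isArc_le [DecidableRel G.Adj] (hG : G.IsRegularOfDegree 3) (n : ℕ) :
    (Finset.univ.filter (G.IsArc (n + 1))).card ≤ 3 * 2 ^ n * Fintype.card V := by
  induction n with
  | zero =>
    refine (card_isArc_succ_le (k := 3) (fun r => G.neighborFinset (r (Fin.last _)))
      (fun q hq => ?_) fun r _ => (hG _).le).trans ?_
    · rw [mem_neighborFinset]
      exact hq.adj (Fin.last _)
    · rw [pow_zero, mul_one]
      refine Nat.mul_le_mul_left 3 ((Finset.card_le_univ _).trans_eq ?_)
      simp
  | succ n ih =>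
    refine (card_isArc_succ_le (k := 2)
      (fun r => (G.neighborFinset (r (Fin.last _))).erase (r (Fin.last n).castSucc))
      (fun q hq => ?_) fun r hr => ?_).trans ?_
    · rw [Finset.mem_erase, mem_neighborFinset]
      exact ⟨(hq.ne n (by omega)).symm, hq.adj (Fin.last _)⟩
    -- a prolongation avoids the last vertex but one, which is one of the three neighbours
    · rw [Finset.card_erase_of_mem, card_neighborFinset_eq_degree, hG]
      rw [mem_neighborFinset]
      exact (hr.adj (Fin.last _)).symm
    · rw [pow_succ, ← mul_assoc, mul_comm _ 2, mul_assoc 2]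
      exact Nat.mul_le_mul_left 2 ih

open Classical in
lemma IsArcRegular.card_aut_le {s : ℕ} (hs : G.IsArcRegular s) :
    Nat.card (G ≃g G) ≤ (Finset.univ.filter (G.IsArc s)).card := by
  obtain ⟨⟨⟨p, hp⟩, -⟩, huniq⟩ := hs
  have hmap : ∀ f : G ≃g G, G.IsArc s (f ∘ p) := fun f =>
    ⟨fun i => f.map_adj_iff.2 (hp.adj i), fun i hi h => hp.ne i hi (f.injective h)⟩
  rw [← Fintype.card_coe, ← Nat.card_eq_fintype_card]
  refine Nat.card_le_card_of_injective (fun f : G ≃g G => ⟨f ∘ p, by simpa using hmap f⟩)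
    fun f h hfh => ?_
  have : f ∘ p = h ∘ p := congrArg Subtype.val hfh
  exact huniq p (f ∘ p) hp (hmap f) f h (fun _ => rfl) fun i => (congrFun this i).symm

end Counting

end SimpleGraph

theorem mainTheorem12 {V : Type*} [Fintype V] (G : SimpleGraph V) [DecidableRel G.Adj]
    (s t : ℕ) (hconn : G.Connected) (hcubic : G.IsRegularOfDegree 3)
    (hs : G.IsArcRegular s) (ht : G.IsArcTransitive t) :
    Nat.card (G ≃g G) ≤ 48 * Fintype.card V := by
  classical
  have hs5 : s ≤ 5 := by
    by_contra! h
    obtain ⟨F⟩ := hs.nonempty_arcFrame hcubic (by omega)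
    have := F.le_five hconn.preconnected
    omega
  refine hs.card_aut_le.trans ?_
  cases s with
  | zero =>
    refine (Finset.card_le_univ _).trans ?_
    simp
    omega
  | succ n =>
    refine (SimpleGraph.card_isArc_le hcubic n).trans (Nat.mul_le_mul_right _ ?_)
    have : 2 ^ n ≤ 2 ^ 4 := Nat.pow_le_pow_right (by norm_num) (by omega)
    omega
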